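/- \textbf{Theorem.} A \emph{curvature function} is a $C^\infty$ function $\kappa:\mathbb R\to(0,\infty)$. A planar curve \emph{with curvature} $\kappa$ is a $C^\infty$ map $P:\mathbb R\to\mathbb R^2$ with $|P'(s)|=1$ and $|P''(s)|=\kappa(s)$ for all $s$. It is \emph{immersed} if it is smooth with nowhere vanishing derivative, and \emph{embedded} if moreover it is a homeomorphism onto its image with the inherited topology. A function $f$ \emph{exceeds} $g$ if $f\ge g$ everywhere and $f>g$ somewhere. An \emph{arc of curvature functions} on $(-\tau,\tau)$ is a family $(\kappa_t)_{|t|<\tau}$ of curvature functions such that $t\mapsto\kappa_t(s)$ is $C^1$ for every $s$. For every $k>0$ there are an arclength parametrization $P$ of the parabola $y=kx^2$, with curvature function $\kappa_{\mathrm{parabola}}$, a $C^\infty$ function $\beta:\mathbb R\to[0,1]$ with support $[-1,1]$, and $\tau>0$, such that $$\kappa_t(s)=\kappa_{\mathrm{parabola}}(s)+t\,\beta(s),\qquad |t|<\tau,$$ is an arc of curvature functions, each $\kappa_t$ is the curvature of some planar curve, and, whenever $P_t$ is a planar curve with curvature $\kappa_t$ and $|t|,|t_1|,|t_2|<\tau$: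 \begin{itemize} \item[(a)] If $t_2>t_1$ then $\kappa_{t_2}$ exceeds $\kappa_{t_1}$. \item[(b)] If $t<0$ then $P_t$ is embedded. \item[(c)] If $t>0$ then $P_t$ is immersed but not embedded. \item[(d)] $P_0$ is (i.e. has as its image) a parabola. \item[(e)] For every $\eta>0$ there is a continuous $\delta:\mathbb R\to(0,\infty)$ with the following property. Let $(\widetilde\kappa_t)_{|t|<\tau}$ be an arc of curvature functions with $$|\widetilde\kappa_t(s)-\kappa_t(s)|<\delta(s)\quad\text{and}\quad |\partial_t\widetilde\kappa_t(s)-\partial_t\kappa_t(s)|<\delta(s)\qquad\text{for all } |t|<\tau,\ s\in\mathbb R.$$ Then each $\widetilde\kappa_t$ is the curvature of some planar curve, and there is exactly one $c\in(-\tau,\tau)$ such that, for $|t|<\tau$, every planar curve with curvature $\widetilde\kappa_t$ is embedded if $t<c$, and is immersed but not embedded if $t>c$. Moreover $|c|<\eta$. \end{itemize} -/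

import Mathlib

open scoped ContDiff

namespace PlaneCurve

/-- The Euclidean plane. -/
abbrev Plane : Type := EuclideanSpace ℝ (Fin 2)

/-- A smooth complete plane curve parametrized by arclength over the whole line. -/
structure IsUnitSpeed (P : ℝ → Plane) : Prop where
  smooth : ContDiff ℝ ∞ P
  speed : ∀ s, ‖deriv P s‖ = 1

/-- The curvature of an arclength parametrized curve: the length of its acceleration. -/
noncomputable def curvature (P : ℝ → Plane) (s : ℝ) : ℝ := ‖deriv (deriv P) s‖

/-- `P` is a plane curve, parametrized by arclength, whose curvature function is `κ`. -/
structure HasCurvature (P : ℝ → Plane) (κ : ℝ → ℝ) : Prop where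
  unitSpeed : IsUnitSpeed P
  curvature_eq : ∀ s, curvature P s = κ s

/-- A smooth immersion of the line in the plane. -/
def IsImmersed (P : ℝ → Plane) : Prop := ContDiff ℝ ∞ P ∧ ∀ s, deriv P s ≠ 0

/-- An embedded curve: an immersion which is a homeomorphism onto its image. -/
def IsEmbedded (P : ℝ → Plane) : Prop := IsImmersed P ∧ Topology.IsEmbedding P

/-- The parabola `y = k x ^ 2`. -/
def standardParabola (k : ℝ) : Set Plane := {p | p 1 = k * p 0 ^ 2}

/-- A parabola: a set congruent to `y = k x ^ 2` for some `k > 0`. -/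
def IsParabola (S : Set Plane) : Prop :=
  ∃ k : ℝ, 0 < k ∧ ∃ Φ : Plane ≃ᵢ Plane, S = Φ '' standardParabola k

/-- The function `f` exceeds the function `g`. -/
def Exceeds (f g : ℝ → ℝ) : Prop := (∀ s, g s ≤ f s) ∧ ∃ s, g s < f s

/-- The space of curvature functions: smooth and nowhere vanishing (positive). -/
structure IsCurvatureFunction (κ : ℝ → ℝ) : Prop where
  smooth : ContDiff ℝ ∞ κ
  pos : ∀ s, 0 < κ s

/-- A smooth bump function with values in `[0, 1]` and support `[-1, 1]`. -/
structure IsBump (β : ℝ → ℝ) : Prop where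
  smooth : ContDiff ℝ ∞ β
  mem_Icc : ∀ s, β s ∈ Set.Icc (0 : ℝ) 1
  support_eq : tsupport β = Set.Icc (-1) 1

/-- An arc `t ↦ κ t` of curvature functions, defined for `t` in the interval `(-τ, τ)`, which
is continuously differentiable in the parameter `t`. -/
structure IsArc (τ : ℝ) (κ : ℝ → ℝ → ℝ) : Prop where
  mem : ∀ t ∈ Set.Ioo (-τ) τ, IsCurvatureFunction (κ t)
  contDiffOn : ∀ s, ContDiffOn ℝ 1 (fun t => κ t s) (Set.Ioo (-τ) τ)

/-- The arc `κ'` is `δ`-close to the arc `κ` on `(-τ, τ)`: closeness of values and of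
`t`-derivatives (so that transversality makes sense), measured in the Whitney topology, where
the size of the allowed deviation is a function `δ` of the arclength `s`. -/
def ArcClose (τ : ℝ) (δ : ℝ → ℝ) (κ' κ : ℝ → ℝ → ℝ) : Prop :=
  ∀ t ∈ Set.Ioo (-τ) τ, ∀ s,
    |κ' t s - κ t s| < δ s ∧
      |deriv (fun u => κ' u s) t - deriv (fun u => κ u s) t| < δ s

/-- On `(-τ, τ)`, the curves with curvature functions `κ t` pass at `t = c` from embedded
curves to immersed curves that are not embedded. -/
structure CrossesAt (τ : ℝ) (κ : ℝ → ℝ → ℝ) (c : ℝ) : Prop where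
  mem : c ∈ Set.Ioo (-τ) τ
  embedded : ∀ t ∈ Set.Ioo (-τ) τ, t < c → ∀ P, HasCurvature P (κ t) → IsEmbedded P
  not_embedded : ∀ t ∈ Set.Ioo (-τ) τ, c < t → ∀ P, HasCurvature P (κ t) →
    IsImmersed P ∧ ¬ IsEmbedded P

end PlaneCurve

/-!
The dichotomy between embedded and self-intersecting curves is governed by the total curvature
`Θ = ∫ κ`, the angle through which the tangent turns.

A positive curvature function determines its curve up to an isometry of the plane
(`HasCurvature.exists_isometry`), so every question about a curve with curvature `κ` can be
decided on a model in `ℂ` with tangent `exp (i θ)`, `θ' = κ`, where the constant of integration is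
chosen such that `θ` tends to `± Θ / 2` at the two ends.

* If `Θ < π`, then `|θ| < π / 2`, so the real part of the curve increases strictly and the curve is
  embedded (`HasCurvature.isEmbedded_of_integral_lt_pi`).
* If `π < Θ < 2 π`, both ends go up to infinity, the right end goes to the left and the left end to
  the right. Parametrizing the two branches above the lowest point by height, their horizontal
  distance is positive at small heights and negative at large ones, and a zero in between is a
  self-intersection (`HasTangentAngle.not_injective`,
  `HasCurvature.not_isEmbedded_of_pi_lt_integral`).

The tangent angle of the parabola is the arctangent of its slope, which gives `Θ = π`
(`exists_parabola`). Adding `t β` to its curvature changes `Θ` to `π + t ∫ β`, which settles the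
unperturbed arc. For a perturbed arc whose values and `t`-derivatives deviate by less than an
integrable `δ` with `∫ δ < ∫ β`, the mean value inequality shows that `Θ` is still a continuous and
strictly increasing function of `t` (`ArcClose.integral`). If `∫ δ` is small against `η ∫ β`, it
takes the value `π` at some `c` with `|c| < η`, and the curves pass from embedded to
self-intersecting there (`crossesAt_of_integral_eq_pi`).
-/

open MeasureTheory Filter Topology Set

namespace PlaneCurve

/-! ### Tangent angles -/

/-- The identification of the complex plane with the Euclidean plane. -/
noncomputable def toPlane : ℂ ≃ₗᵢ[ℝ] Plane := Complex.orthonormalBasisOneI.repr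

/-- `Z` is a curve in the complex plane with unit tangent vector `exp (i θ)`, and the tangent
angle `θ` turns at the rate `κ`. -/
structure HasTangentAngle (Z : ℝ → ℂ) (θ κ : ℝ → ℝ) : Prop where
  hasDerivAt_curve : ∀ s, HasDerivAt Z (Complex.exp (θ s * Complex.I)) s
  hasDerivAt_angle : ∀ s, HasDerivAt θ (κ s) s

lemma IsUnitSpeed.isImmersed {P : ℝ → Plane} (h : IsUnitSpeed P) : IsImmersed P :=
  ⟨h.smooth, fun s hs => by simpa [hs] using h.speed s⟩

lemma contDiff_infty_of_hasDerivAt {F : Type*} [NormedAddCommGroup F] [NormedSpace ℝ F]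
    {f f' : ℝ → F} (h : ∀ s, HasDerivAt f (f' s) s) (h' : ContDiff ℝ ∞ f') :
    ContDiff ℝ ∞ f :=
  contDiff_infty_iff_deriv.2
    ⟨fun s => (h s).differentiableAt, by rwa [funext fun s => (h s).deriv]⟩

namespace HasTangentAngle

variable {Z : ℝ → ℂ} {θ κ : ℝ → ℝ}

lemma hasDerivAt_re (h : HasTangentAngle Z θ κ) (s : ℝ) :
    HasDerivAt (fun u => (Z u).re) (Real.cos (θ s)) s := by
  have := Complex.reCLM.hasFDerivAt.comp_hasDerivAt s (h.hasDerivAt_curve s)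
  exact this.congr_deriv (Complex.exp_ofReal_mul_I_re _)

lemma hasDerivAt_im (h : HasTangentAngle Z θ κ) (s : ℝ) :
    HasDerivAt (fun u => (Z u).im) (Real.sin (θ s)) s := by
  have := Complex.imCLM.hasFDerivAt.comp_hasDerivAt s (h.hasDerivAt_curve s)
  exact this.congr_deriv (Complex.exp_ofReal_mul_I_im _)

lemma hasDerivAt_tangent (h : HasTangentAngle Z θ κ) (s : ℝ) :
    HasDerivAt (fun u => Complex.exp (θ u * Complex.I))
      (Complex.exp (θ s * Complex.I) * (κ s * Complex.I)) s :=
  ((h.hasDerivAt_angle s).ofReal_comp.mul_const Complex.I).cexp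

lemma hasCurvature (h : HasTangentAngle Z θ κ) (hκ : IsCurvatureFunction κ) :
    HasCurvature (fun s => toPlane (Z s)) κ := by
  have h1 : ∀ s, HasDerivAt (fun u => toPlane (Z u)) (toPlane (Complex.exp (θ s * Complex.I))) s :=
    fun s => toPlane.toContinuousLinearEquiv.hasFDerivAt.comp_hasDerivAt s (h.hasDerivAt_curve s)
  have h2 : ∀ s, HasDerivAt (fun u => toPlane (Complex.exp (θ u * Complex.I)))
      (toPlane (Complex.exp (θ s * Complex.I) * (κ s * Complex.I))) s :=
    fun s => toPlane.toContinuousLinearEquiv.hasFDerivAt.comp_hasDerivAt s (h.hasDerivAt_tangent s)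
  have hθ : ContDiff ℝ ∞ θ := contDiff_infty_of_hasDerivAt h.hasDerivAt_angle hκ.smooth
  have hd := funext fun s => (h1 s).deriv
  refine ⟨⟨contDiff_infty_of_hasDerivAt h1 ?_, fun s => ?_⟩, fun s => ?_⟩
  · exact toPlane.contDiff.comp
      (((Complex.ofRealCLM.contDiff.comp hθ).mul contDiff_const).cexp)
  · rw [hd, LinearIsometryEquiv.norm_map, Complex.norm_exp_ofReal_mul_I]
  · rw [curvature, hd, (h2 s).deriv, LinearIsometryEquiv.norm_map, norm_mul,
      Complex.norm_exp_ofReal_mul_I]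
    simp [abs_of_pos (hκ.pos s)]

end HasTangentAngle

lemma IsCurvatureFunction.intervalIntegrable {κ : ℝ → ℝ} (hκ : IsCurvatureFunction κ) (a b : ℝ) :
    IntervalIntegrable κ volume a b :=
  hκ.smooth.continuous.intervalIntegrable a b

lemma IsCurvatureFunction.exists_hasTangentAngle {κ : ℝ → ℝ} (hκ : IsCurvatureFunction κ)
    (m : ℝ) : ∃ Z, HasTangentAngle Z (fun s => (∫ u in (0 : ℝ)..s, κ u) - m) κ := by
  have hθ : ∀ s, HasDerivAt (fun s => (∫ u in (0 : ℝ)..s, κ u) - m) (κ s) s := fun s =>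
    (hκ.smooth.continuous.integral_hasStrictDerivAt 0 s).hasDerivAt.sub_const m
  have hc : Continuous fun s => (∫ u in (0 : ℝ)..s, κ u) - m :=
    continuous_iff_continuousAt.2 fun s => (hθ s).continuousAt
  refine ⟨fun s => ∫ v in (0 : ℝ)..s,
    Complex.exp (((∫ u in (0 : ℝ)..v, κ u) - m : ℝ) * Complex.I), fun s => ?_, hθ⟩
  exact (Continuous.integral_hasStrictDerivAt
    (f := fun v => Complex.exp (((∫ u in (0 : ℝ)..v, κ u) - m : ℝ) * Complex.I))
    (by fun_prop) 0 s).hasDerivAt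

lemma IsCurvatureFunction.exists_hasCurvature {κ : ℝ → ℝ} (hκ : IsCurvatureFunction κ) :
    ∃ P, HasCurvature P κ := by
  obtain ⟨Z, hZ⟩ := hκ.exists_hasTangentAngle 0
  exact ⟨_, hZ.hasCurvature hκ⟩

/-! ### Congruence of curves with the same curvature -/

lemma eq_of_hasDerivAt_zero {f : ℝ → ℂ} (h : ∀ s, HasDerivAt f 0 s) (s : ℝ) : f s = f 0 :=
  is_const_of_deriv_eq_zero (fun u => (h u).differentiableAt) (fun u => (h u).deriv) s 0

/-- A unit speed curve whose tangent `u` satisfies `u' = i κ u` is a rotated and translated copy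
of any curve whose tangent angle turns at the rate `κ`. -/
lemma HasTangentAngle.exists_eq_rotation_add {Z W u : ℝ → ℂ} {θ κ : ℝ → ℝ}
    (h : HasTangentAngle Z θ κ) (hW : ∀ s, HasDerivAt W (u s) s) (hu : ∀ s, ‖u s‖ = 1)
    (hu' : ∀ s, HasDerivAt u (κ s * Complex.I * u s) s) :
    ∃ (c : Circle) (d : ℂ), ∀ s, W s = rotation c (Z s) + d := by
  -- The quotient of the two tangents is constant.
  have h1 : ∀ s, HasDerivAt (fun v => u v * Complex.exp (-(θ v * Complex.I))) 0 s := by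
    intro s
    exact ((hu' s).mul
      (((h.hasDerivAt_angle s).ofReal_comp.mul_const Complex.I).neg.cexp)).congr_deriv (by ring)
  set c := u 0 * Complex.exp (-(θ 0 * Complex.I)) with hc
  have h2 : ∀ s, u s = c * Complex.exp (θ s * Complex.I) := by
    intro s
    rw [hc, ← eq_of_hasDerivAt_zero h1 s, mul_assoc, ← Complex.exp_add]
    simp
  have hcn : ‖c‖ = 1 := by
    have := hu 0
    rwa [h2 0, norm_mul, Complex.norm_exp_ofReal_mul_I, mul_one] at this
  have h3 : ∀ s, HasDerivAt (fun v => W v - c * Z v) 0 s := by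
    intro s
    have := (hW s).sub ((h.hasDerivAt_curve s).const_mul c)
    rwa [h2 s, sub_self] at this
  obtain ⟨r, hr⟩ : ∃ r : Circle, (r : ℂ) = c :=
    ⟨⟨c, show c ∈ Metric.sphere (0 : ℂ) 1 from mem_sphere_zero_iff_norm.2 hcn⟩, rfl⟩
  refine ⟨r, W 0 - c * Z 0, fun s => ?_⟩
  rw [rotation_apply, hr, ← eq_of_hasDerivAt_zero h3 s]
  simp

/-- The acceleration of a unit speed curve is orthogonal to the tangent. As the curvature
vanishes nowhere, the curve keeps turning to the same side. -/
lemma exists_sign_of_norm_deriv {u u' : ℝ → ℂ} {κ : ℝ → ℝ} (hκ : Continuous κ)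
    (hpos : ∀ s, 0 < κ s) (hu' : ∀ s, HasDerivAt u (u' s) s) (hc : Continuous u')
    (hu : ∀ s, ‖u s‖ = 1) (hn : ∀ s, ‖u' s‖ = κ s) :
    (∀ s, u' s = κ s * Complex.I * u s) ∨ (∀ s, u' s = -(κ s * Complex.I * u s)) := by
  have hre : ∀ s, (u s).re * (u' s).re + (u s).im * (u' s).im = 0 := by
    intro s
    have h1 : HasDerivAt (fun v => (u v).re) (u' s).re s :=
      Complex.reCLM.hasFDerivAt.comp_hasDerivAt s (hu' s)
    have h2 : HasDerivAt (fun v => (u v).im) (u' s).im s :=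
      Complex.imCLM.hasFDerivAt.comp_hasDerivAt s (hu' s)
    have h3 := (h1.mul h1).add (h2.mul h2)
    have h4 : (fun v => (u v).re) * (fun v => (u v).re) + (fun v => (u v).im) * (fun v => (u v).im)
        = fun _ => (1 : ℝ) := by
      funext v
      have := Complex.sq_norm (u v)
      rw [hu, Complex.normSq_apply] at this
      simpa using this.symm
    rw [h4] at h3
    linarith [h3.unique (hasDerivAt_const s (1 : ℝ))]
  have hone : ∀ s, (u s).re * (u s).re + (u s).im * (u s).im = 1 := fun s => by
    have := Complex.sq_norm (u s)
    rw [hu, Complex.normSq_apply] at this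
    linarith
  have hsq : ∀ s, (u' s).re * (u' s).re + (u' s).im * (u' s).im = κ s ^ 2 := fun s => by
    have := Complex.sq_norm (u' s)
    rw [hn, Complex.normSq_apply] at this
    linarith
  have hcu : Continuous u := continuous_iff_continuousAt.2 fun s => (hu' s).continuousAt
  -- The signed curvature: the determinant of tangent and acceleration.
  set σ : ℝ → ℝ := fun s => (u s).re * (u' s).im - (u s).im * (u' s).re with hσ
  have hσc : Continuous σ := by
    have h1 := Complex.continuous_re
    have h2 := Complex.continuous_im
    fun_prop
  have key : ∀ s, u' s = σ s * Complex.I * u s := by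
    intro s
    apply Complex.ext
    · simp [hσ]
      linear_combination (u s).re * hre s - (u' s).re * hone s
    · simp [hσ]
      linear_combination (u s).im * hre s - (u' s).im * hone s
  have hσsq : EqOn (σ ^ 2) (κ ^ 2) univ := fun s _ => by
    simp only [Pi.pow_apply, ← hsq s, hσ]
    linear_combination ((u' s).re ^ 2 + (u' s).im ^ 2) * hone s
      - ((u s).re * (u' s).re + (u s).im * (u' s).im) * hre s
  rcases isPreconnected_univ.eq_or_eq_neg_of_sq_eq hσc.continuousOn hκ.continuousOn hσsq
    (fun {s} _ => (hpos s).ne') with h | h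
  · left
    intro s
    rw [key, h (mem_univ s)]
  · right
    intro s
    rw [key, h (mem_univ s)]
    simp

/-- Two curves with the same positive curvature function differ by an isometry of the plane. -/
lemma HasCurvature.exists_isometry {P : ℝ → Plane} {κ : ℝ → ℝ} (hP : HasCurvature P κ)
    (hκ : IsCurvatureFunction κ) {Z : ℝ → ℂ} {θ : ℝ → ℝ} (hZ : HasTangentAngle Z θ κ) :
    ∃ Φ : Plane ≃ᵢ Plane, ∀ s, P s = Φ (toPlane (Z s)) := by
  have hd1 : ∀ s, HasDerivAt P (deriv P s) s := fun s =>
    (hP.unitSpeed.smooth.differentiable (by simp) s).hasDerivAt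
  have hs2 := (contDiff_infty_iff_deriv.1 hP.unitSpeed.smooth).2
  have hd2 : ∀ s, HasDerivAt (deriv P) (deriv (deriv P) s) s := fun s =>
    (hs2.differentiable (by simp) s).hasDerivAt
  have hs3 := (contDiff_infty_iff_deriv.1 hs2).2.continuous
  have hW : ∀ s, HasDerivAt (fun v => toPlane.symm (P v)) (toPlane.symm (deriv P s)) s := fun s =>
    toPlane.symm.toContinuousLinearEquiv.hasFDerivAt.comp_hasDerivAt s (hd1 s)
  have hu : ∀ s, HasDerivAt (fun v => toPlane.symm (deriv P v))
      (toPlane.symm (deriv (deriv P) s)) s := fun s =>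
    toPlane.symm.toContinuousLinearEquiv.hasFDerivAt.comp_hasDerivAt s (hd2 s)
  have hn : ∀ s, ‖toPlane.symm (deriv P s)‖ = 1 := fun s => by
    rw [LinearIsometryEquiv.norm_map, hP.unitSpeed.speed]
  rcases exists_sign_of_norm_deriv hκ.smooth.continuous hκ.pos hu
    (toPlane.symm.continuous.comp hs3) hn
    (fun s => by rw [LinearIsometryEquiv.norm_map]; exact hP.curvature_eq s) with h | h
  · obtain ⟨c, d, hcd⟩ := hZ.exists_eq_rotation_add hW hn (fun s => by rw [← h s]; exact hu s)
    refine ⟨(toPlane.symm.toIsometryEquiv.trans ((rotation c).toIsometryEquiv.trans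
      (IsometryEquiv.addRight d))).trans toPlane.toIsometryEquiv, fun s => ?_⟩
    simp only [IsometryEquiv.trans_apply, LinearIsometryEquiv.coe_toIsometryEquiv,
      LinearIsometryEquiv.symm_apply_apply, IsometryEquiv.addRight_apply, ← hcd]
    simp
  · -- A curve turning clockwise is reflected first.
    have hW' : ∀ s, HasDerivAt (fun v => Complex.conjLIE (toPlane.symm (P v)))
        (Complex.conjLIE (toPlane.symm (deriv P s))) s := fun s =>
      Complex.conjLIE.toContinuousLinearEquiv.hasFDerivAt.comp_hasDerivAt s (hW s)
    have hu' : ∀ s, HasDerivAt (fun v => Complex.conjLIE (toPlane.symm (deriv P v)))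
        (Complex.conjLIE (toPlane.symm (deriv (deriv P) s))) s := fun s =>
      Complex.conjLIE.toContinuousLinearEquiv.hasFDerivAt.comp_hasDerivAt s (hu s)
    obtain ⟨c, d, hcd⟩ := hZ.exists_eq_rotation_add hW'
      (fun s => by rw [LinearIsometryEquiv.norm_map, hn]) (fun s => by
        convert hu' s using 1
        rw [h s]
        simp)
    refine ⟨(toPlane.symm.toIsometryEquiv.trans ((rotation c).toIsometryEquiv.trans
      ((IsometryEquiv.addRight d).trans Complex.conjLIE.toIsometryEquiv))).trans
        toPlane.toIsometryEquiv, fun s => ?_⟩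
    simp only [IsometryEquiv.trans_apply, LinearIsometryEquiv.coe_toIsometryEquiv,
      LinearIsometryEquiv.symm_apply_apply, IsometryEquiv.addRight_apply, ← hcd]
    simp

/-! ### Total curvature and self-intersection -/

lemma HasTangentAngle.isEmbedding {Z : ℝ → ℂ} {θ κ : ℝ → ℝ} (h : HasTangentAngle Z θ κ)
    (hθ : ∀ s, |θ s| < Real.pi / 2) : IsEmbedding Z := by
  have hc : Continuous Z := continuous_iff_continuousAt.2 fun s =>
    (h.hasDerivAt_curve s).continuousAt
  have hre : Continuous fun s => (Z s).re := Complex.continuous_re.comp hc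
  have hm : StrictMono fun s => (Z s).re := strictMono_of_deriv_pos fun s => by
    rw [(h.hasDerivAt_re s).deriv]
    exact Real.cos_pos_of_mem_Ioo (abs_lt.1 (hθ s))
  exact (hm.isEmbedding_of_ordConnected
    (isPreconnected_range hre).ordConnected).of_comp hc Complex.continuous_re

lemma tendsto_atTop_of_hasDerivAt_ge {f f' : ℝ → ℝ} {a ε : ℝ} (hε : 0 < ε)
    (hf : ∀ s, HasDerivAt f (f' s) s) (h : ∀ s, a < s → ε ≤ f' s) : Tendsto f atTop atTop := by
  have hle : ∀ s, a ≤ s → f a + ε * (s - a) ≤ f s := by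
    intro s hs
    have := (convex_Ici a).mul_sub_le_image_sub_of_le_deriv
      (continuous_iff_continuousAt.2 fun s => (hf s).continuousAt).continuousOn
      (fun s _ => (hf s).differentiableAt.differentiableWithinAt) (C := ε)
      (fun s hs => by rw [(hf s).deriv]; exact h s (by simpa using hs)) a self_mem_Ici s hs hs
    linarith
  refine tendsto_atTop_mono' atTop ((eventually_ge_atTop a).mono hle) ?_
  exact tendsto_atTop_add_const_left _ _
    ((tendsto_atTop_add_const_right _ (-a) tendsto_id).const_mul_atTop hε)

/-- If the tangent angle increases from below `-π / 2` to above `π / 2` while staying away from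
`±π`, the height above the lowest point increases to infinity along both branches, and the
right branch eventually crosses over to the left of the left branch. -/
lemma HasTangentAngle.not_injective {Z : ℝ → ℂ} {θ κ : ℝ → ℝ} (h : HasTangentAngle Z θ κ)
    (hκ : ∀ s, 0 < κ s) {φ a b : ℝ} (hφ : φ < Real.pi) (hθ : ∀ s, |θ s| ≤ φ)
    (ha : θ a < -(Real.pi / 2)) (hb : Real.pi / 2 < θ b) : ¬ Function.Injective Z := by
  have hpi := Real.pi_pos
  have hmono : StrictMono θ := strictMono_of_deriv_pos fun s => by
    rw [(h.hasDerivAt_angle s).deriv]; exact hκ s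
  have hθc : Continuous θ := continuous_iff_continuousAt.2 fun s =>
    (h.hasDerivAt_angle s).continuousAt
  have hxc : Continuous fun s => (Z s).re := continuous_iff_continuousAt.2 fun s =>
    (h.hasDerivAt_re s).continuousAt
  have hyc : Continuous fun s => (Z s).im := continuous_iff_continuousAt.2 fun s =>
    (h.hasDerivAt_im s).continuousAt
  have hab : a < b := hmono.lt_iff_lt.1 (by linarith)
  obtain ⟨o, ho, hθo⟩ : ∃ o ∈ Icc a b, θ o = 0 :=
    intermediate_value_Icc hab.le hθc.continuousOn ⟨by linarith, by linarith⟩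
  have hao : a < o := hmono.lt_iff_lt.1 (by linarith)
  have hob : o < b := hmono.lt_iff_lt.1 (by linarith)
  -- The horizontal coordinate runs to `-∞` at the right end and to `∞` at the left end.
  have hcos : ∀ {t r : ℝ}, Real.pi / 2 < r → r ≤ t → t ≤ φ →
      -Real.cos r ≤ -Real.cos t := fun h1 h2 h3 =>
    neg_le_neg (Real.cos_le_cos_of_nonneg_of_le_pi (by linarith) (by linarith) h2)
  have hxr : Tendsto (fun s => -(Z s).re) atTop atTop := by
    refine tendsto_atTop_of_hasDerivAt_ge (a := b) (ε := -Real.cos (θ b)) ?_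
      (fun s => (h.hasDerivAt_re s).neg) fun s hs =>
        hcos hb (hmono hs).le (le_of_abs_le (hθ s))
    have := Real.cos_neg_of_pi_div_two_lt_of_lt hb (by linarith [le_of_abs_le (hθ b)])
    linarith
  have hxl : Tendsto (fun s => (Z (-s)).re) atTop atTop := by
    refine tendsto_atTop_of_hasDerivAt_ge (a := -a) (ε := -Real.cos (-θ a))
      (f' := fun s => -Real.cos (-θ (-s))) ?_ (fun s => ?_) fun s hs =>
        hcos (by linarith) (neg_le_neg (hmono (neg_lt.1 hs)).le) ?_
    · have := Real.cos_neg_of_pi_div_two_lt_of_lt (x := -θ a) (by linarith)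
        (by linarith [neg_le_of_abs_le (hθ a)])
      linarith
    · exact ((h.hasDerivAt_re (-s)).scomp s (hasDerivAt_neg s)).congr_deriv (by simp)
    · linarith [neg_le_of_abs_le (hθ (-s))]
  -- The same for the vertical coordinate.
  have hsin : ∀ {t r : ℝ}, 0 < r → r ≤ t → t ≤ φ →
      min (Real.sin r) (Real.sin φ) ≤ Real.sin t := by
    intro t r h1 h2 h3
    rcases le_total t (Real.pi / 2) with h4 | h4
    · exact (min_le_left _ _).trans (Real.sin_le_sin_of_le_of_le_pi_div_two (by linarith) h4 h2)
    · rw [← Real.sin_pi_sub φ, ← Real.sin_pi_sub t]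
      exact (min_le_right _ _).trans
        (Real.sin_le_sin_of_le_of_le_pi_div_two (by linarith) (by linarith) (by linarith))
  have hφ0 : 0 < φ := by linarith [le_of_abs_le (hθ b)]
  have hsφ : 0 < Real.sin φ := Real.sin_pos_of_pos_of_lt_pi hφ0 hφ
  have hyr : Tendsto (fun s => (Z s).im) atTop atTop := by
    refine tendsto_atTop_of_hasDerivAt_ge (a := b) (ε := min (Real.sin (θ b)) (Real.sin φ)) ?_
      h.hasDerivAt_im fun s hs => hsin (by linarith) (hmono hs).le (le_of_abs_le (hθ s))
    exact lt_min (Real.sin_pos_of_pos_of_lt_pi (by linarith)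
      (by linarith [le_of_abs_le (hθ b)])) hsφ
  have hyl : Tendsto (fun s => (Z (-s)).im) atTop atTop := by
    refine tendsto_atTop_of_hasDerivAt_ge (a := -a) (ε := min (Real.sin (-θ a)) (Real.sin φ))
      (f' := fun s => Real.sin (-θ (-s))) ?_ (fun s => ?_) fun s hs =>
        hsin (by linarith) (neg_le_neg (hmono (neg_lt.1 hs)).le) ?_
    · exact lt_min (Real.sin_pos_of_pos_of_lt_pi (by linarith)
        (by linarith [neg_le_of_abs_le (hθ a)])) hsφ
    · exact ((h.hasDerivAt_im (-s)).scomp s (hasDerivAt_neg s)).congr_deriv (by simp)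
    · linarith [neg_le_of_abs_le (hθ (-s))]
  have hymr : StrictMonoOn (fun s => (Z s).im) (Ici o) := by
    refine strictMonoOn_of_deriv_pos (convex_Ici o) hyc.continuousOn fun s hs => ?_
    rw [(h.hasDerivAt_im s).deriv]
    have : θ o < θ s := hmono (by simpa using hs)
    exact Real.sin_pos_of_pos_of_lt_pi (by linarith) (by linarith [le_of_abs_le (hθ s)])
  have hyml : StrictAntiOn (fun s => (Z s).im) (Iic o) := by
    refine strictAntiOn_of_deriv_neg (convex_Iic o) hyc.continuousOn fun s hs => ?_
    rw [(h.hasDerivAt_im s).deriv]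
    have : θ s < θ o := hmono (by simpa using hs)
    exact Real.sin_neg_of_neg_of_neg_pi_lt (by linarith) (by linarith [neg_le_of_abs_le (hθ s)])
  -- The signed height above the lowest point, negative on the left branch, is a homeomorphism
  -- of the line; its inverse parametrizes the two branches by height.
  set Y : ℝ → ℝ := fun s => if s ≤ o then (Z o).im - (Z s).im else (Z s).im - (Z o).im with hY
  have hYr : ∀ s, o ≤ s → Y s = (Z s).im - (Z o).im := by
    intro s hs
    rcases hs.eq_or_lt with rfl | hs
    · simp [hY]
    · simp [hY, not_le.2 hs]
  have hYl : ∀ s, s ≤ o → Y s = (Z o).im - (Z s).im := fun s hs => by simp [hY, hs]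
  have hYm : StrictMono Y := by
    rw [← strictMonoOn_univ, ← Iic_union_Ici (a := o)]
    refine StrictMonoOn.union (c := o) ?_ ?_ isGreatest_Iic isLeast_Ici
    · intro s hs t ht hst
      rw [hYl s hs, hYl t ht]
      linarith [hyml hs ht hst]
    · intro s hs t ht hst
      rw [hYr s hs, hYr t ht]
      linarith [hymr hs ht hst]
  have hYc : Continuous Y := by
    refine Continuous.if_le (by fun_prop) (by fun_prop) continuous_id continuous_const ?_
    rintro s rfl
    simp
  have hYtop : Tendsto Y atTop atTop :=
    (tendsto_atTop_add_const_right _ (-(Z o).im) hyr).congr' <|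
      (eventually_ge_atTop o).mono fun s hs => by rw [hYr s hs]; ring
  have hYbot : Tendsto Y atBot atBot := by
    have h1 : Tendsto (fun s => (Z s).im) atBot atTop := by
      simpa [Function.comp_def] using hyl.comp tendsto_neg_atBot_atTop
    refine (tendsto_atBot_add_const_left _ (Z o).im (tendsto_neg_atTop_atBot.comp h1)).congr' <|
      (eventually_le_atBot o).mono fun s hs => ?_
    rw [hYl s hs]
    simp [sub_eq_add_neg]
  set G := StrictMono.orderIsoOfSurjective Y hYm (hYc.surjective hYtop hYbot) with hG
  have hGc : Continuous G.symm := G.symm.continuous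
  have hYG : ∀ t, Y (G.symm t) = t := fun t => G.apply_symm_apply t
  have hGo : G.symm 0 = o := by
    rw [OrderIso.symm_apply_eq]
    change 0 = Y o
    simp [hY]
  -- The gap between the right and left branches at a given height.
  set D : ℝ → ℝ := fun t => (Z (G.symm t)).re - (Z (G.symm (-t))).re with hD
  have hDc : Continuous D := (hxc.comp hGc).sub (hxc.comp (hGc.comp continuous_neg))
  obtain ⟨T, hT0, hDT⟩ : ∃ T, 0 < T ∧ D T < 0 := by
    have h1 : Tendsto G.symm atTop atTop := G.symm.tendsto_atTop
    have h2 : Tendsto (fun t => -G.symm (-t)) atTop atTop :=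
      tendsto_neg_atBot_atTop.comp (G.symm.tendsto_atBot.comp tendsto_neg_atTop_atBot)
    have h3 : ∀ᶠ t in atTop, (0 : ℝ) < -(Z (G.symm t)).re :=
      (hxr.comp h1).eventually_gt_atTop 0
    have h4 : ∀ᶠ t in atTop, (0 : ℝ) < (Z (- -G.symm (-t))).re :=
      (hxl.comp h2).eventually_gt_atTop 0
    obtain ⟨T, h5, h6, h7⟩ := (h3.and (h4.and (eventually_gt_atTop 0))).exists
    rw [neg_neg] at h6
    exact ⟨T, h7, by simp only [hD]; linarith⟩
  obtain ⟨ε, hε0, hεT, hDε⟩ : ∃ ε, 0 < ε ∧ ε < T ∧ 0 < D ε := by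
    have hU : Ioo a b ∩ θ ⁻¹' Ioo (-(Real.pi / 2)) (Real.pi / 2) ∈ 𝓝 o :=
      inter_mem (Ioo_mem_nhds hao hob)
        (hθc.continuousAt.preimage_mem_nhds (Ioo_mem_nhds (by linarith) (by linarith)))
    obtain ⟨l, u, ⟨hlo, hou⟩, hlu⟩ := mem_nhds_iff_exists_Ioo_subset.1 hU
    have h1 : ∀ᶠ t in 𝓝 (0 : ℝ), G.symm t ∈ Ioo l u :=
      hGc.continuousAt.eventually (by rw [hGo]; exact Ioo_mem_nhds hlo hou)
    have h2 : ∀ᶠ t in 𝓝 (0 : ℝ), G.symm (-t) ∈ Ioo l u :=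
      (hGc.comp continuous_neg).continuousAt.eventually
        (by simp only [Function.comp, neg_zero, hGo]; exact Ioo_mem_nhds hlo hou)
    have h3 : ∀ᶠ t in 𝓝[>] (0 : ℝ), t ∈ Ioo 0 T := Ioo_mem_nhdsGT hT0
    obtain ⟨ε, h4, h5, h6⟩ := ((h1.filter_mono nhdsWithin_le_nhds).and
      ((h2.filter_mono nhdsWithin_le_nhds).and h3)).exists
    refine ⟨ε, h6.1, h6.2, ?_⟩
    have hm : StrictMonoOn (fun s => (Z s).re) (Ioo l u) := by
      refine strictMonoOn_of_deriv_pos (convex_Ioo l u) hxc.continuousOn fun s hs => ?_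
      rw [(h.hasDerivAt_re s).deriv]
      exact Real.cos_pos_of_mem_Ioo (hlu (by simpa using hs)).2
    exact sub_pos.2 (hm h5 h4 (G.symm.strictMono (by linarith [h6.1])))
  obtain ⟨t, ht, hDt⟩ : ∃ t ∈ Icc ε T, D t = 0 :=
    intermediate_value_Icc' hεT.le hDc.continuousOn ⟨hDT.le, hDε.le⟩
  have ht0 : 0 < t := hε0.trans_le ht.1
  intro hinj
  have h1 : o ≤ G.symm t := by rw [← hGo]; exact G.symm.monotone ht0.le
  have h2 : G.symm (-t) ≤ o := by rw [← hGo]; exact G.symm.monotone (by linarith)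
  have h3 := hYr _ h1
  have h4 := hYl _ h2
  rw [hYG] at h3 h4
  have h5 : Z (G.symm t) = Z (G.symm (-t)) :=
    Complex.ext (sub_eq_zero.1 hDt) (by linarith)
  have h6 := G.symm.injective (hinj h5)
  linarith

/-- The tangent angle of a curve of finite total curvature, normalized so that its limits at the
two ends are opposite. -/
lemma IsCurvatureFunction.exists_balanced_hasTangentAngle {κ : ℝ → ℝ}
    (hκ : IsCurvatureFunction κ) (hi : Integrable κ) :
    ∃ Z θ, HasTangentAngle Z θ κ ∧ (∀ s, |θ s| ≤ (∫ u, κ u) / 2) ∧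
      Tendsto θ atTop (𝓝 ((∫ u, κ u) / 2)) ∧ Tendsto θ atBot (𝓝 (-((∫ u, κ u) / 2))) := by
  set A := ∫ u in Ioi (0 : ℝ), κ u with hA
  set B := ∫ u in Iic (0 : ℝ), κ u with hB
  have hAB : ∫ u, κ u = B + A :=
    (intervalIntegral.integral_Iic_add_Ioi hi.integrableOn hi.integrableOn).symm
  obtain ⟨Z, hZ⟩ := hκ.exists_hasTangentAngle ((A - B) / 2)
  have htop : Tendsto (fun s => (∫ u in (0 : ℝ)..s, κ u) - (A - B) / 2) atTop
      (𝓝 ((∫ u, κ u) / 2)) := by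
    have := (intervalIntegral_tendsto_integral_Ioi 0 hi.integrableOn
      (tendsto_id (α := ℝ))).sub_const ((A - B) / 2)
    rwa [show A - (A - B) / 2 = (∫ u, κ u) / 2 by rw [hAB]; ring] at this
  have hbot : Tendsto (fun s => (∫ u in (0 : ℝ)..s, κ u) - (A - B) / 2) atBot
      (𝓝 (-((∫ u, κ u) / 2))) := by
    have := (intervalIntegral_tendsto_integral_Iic 0 hi.integrableOn
      (tendsto_id (α := ℝ))).neg.sub_const ((A - B) / 2)
    simp only [id, ← intervalIntegral.integral_symm] at this
    rwa [show -B - (A - B) / 2 = -((∫ u, κ u) / 2) by rw [hAB]; ring] at this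
  have hm : Monotone fun s => (∫ u in (0 : ℝ)..s, κ u) - (A - B) / 2 :=
    monotone_of_deriv_nonneg (fun s => (hZ.hasDerivAt_angle s).differentiableAt) fun s => by
      rw [(hZ.hasDerivAt_angle s).deriv]
      exact (hκ.pos s).le
  exact ⟨Z, _, hZ, fun s => abs_le.2 ⟨hm.le_of_tendsto hbot s, hm.ge_of_tendsto htop s⟩,
    htop, hbot⟩

lemma HasCurvature.isEmbedded_of_integral_lt_pi {P : ℝ → Plane} {κ : ℝ → ℝ}
    (hP : HasCurvature P κ) (hκ : IsCurvatureFunction κ) (hi : Integrable κ)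
    (h : ∫ s, κ s < Real.pi) : IsEmbedded P := by
  obtain ⟨Z, θ, hZ, hθ, -, -⟩ := hκ.exists_balanced_hasTangentAngle hi
  obtain ⟨Φ, hΦ⟩ := hP.exists_isometry hκ hZ
  have hemb := Φ.toHomeomorph.isEmbedding.comp (toPlane.toHomeomorph.isEmbedding.comp
    (hZ.isEmbedding fun s => (hθ s).trans_lt (by linarith)))
  exact ⟨hP.unitSpeed.isImmersed, (funext hΦ : P = _) ▸ hemb⟩

lemma HasCurvature.not_isEmbedded_of_pi_lt_integral {P : ℝ → Plane} {κ : ℝ → ℝ}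
    (hP : HasCurvature P κ) (hκ : IsCurvatureFunction κ) (hi : Integrable κ)
    (h : Real.pi < ∫ s, κ s) (h' : ∫ s, κ s < 2 * Real.pi) : ¬ IsEmbedded P := by
  obtain ⟨Z, θ, hZ, hθ, htop, hbot⟩ := hκ.exists_balanced_hasTangentAngle hi
  obtain ⟨Φ, hΦ⟩ := hP.exists_isometry hκ hZ
  obtain ⟨b, hb⟩ := (htop.eventually_const_lt (u := Real.pi / 2) (by linarith)).exists
  obtain ⟨a, ha⟩ := (hbot.eventually_lt_const (u := -(Real.pi / 2)) (by linarith)).exists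
  refine fun hP' => hZ.not_injective hκ.pos (φ := (∫ s, κ s) / 2) (by linarith) hθ ha hb ?_
  intro s t hst
  exact hP'.2.injective (by rw [hΦ, hΦ, hst])

/-! ### The parabola -/

/-- The speed of the parametrization `x ↦ (x, k x ^ 2)` of the parabola. -/
noncomputable def parabolaSpeed (k x : ℝ) : ℝ := √(1 + (2 * k * x) ^ 2)

lemma one_le_parabolaSpeed (k x : ℝ) : 1 ≤ parabolaSpeed k x :=
  Real.one_le_sqrt.2 (by nlinarith [sq_nonneg (2 * k * x)])

lemma contDiff_parabolaSpeed (k : ℝ) : ContDiff ℝ ∞ (parabolaSpeed k) :=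
  ContDiff.sqrt (by fun_prop) fun x => by positivity

/-- The abscissa `X` of the parabola as a function of arclength: the inverse of
`x ↦ ∫₀ˣ speed`. -/
lemma exists_parabola_abscissa (k : ℝ) :
    ∃ X : ℝ → ℝ, ContDiff ℝ ∞ X ∧ (∀ s, HasDerivAt X (parabolaSpeed k (X s))⁻¹ s) ∧
      Tendsto X atTop atTop ∧ Tendsto X atBot atBot ∧ Function.Surjective X := by
  set S : ℝ → ℝ := fun x => ∫ u in (0 : ℝ)..x, parabolaSpeed k u with hS
  have hd : ∀ x, HasDerivAt S (parabolaSpeed k x) x := fun x =>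
    ((contDiff_parabolaSpeed k).continuous.integral_hasStrictDerivAt 0 x).hasDerivAt
  have hpos : ∀ x, 0 < parabolaSpeed k x := fun x =>
    zero_lt_one.trans_le (one_le_parabolaSpeed k x)
  have hSc : Continuous S := continuous_iff_continuousAt.2 fun x => (hd x).continuousAt
  have hm : StrictMono S := strictMono_of_deriv_pos fun x => by rw [(hd x).deriv]; exact hpos x
  have htop : Tendsto S atTop atTop :=
    tendsto_atTop_of_hasDerivAt_ge (a := 0) one_pos hd fun x _ => one_le_parabolaSpeed k x
  have hbot : Tendsto S atBot atBot := by
    have h1 : Tendsto (fun x => -S (-x)) atTop atTop :=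
      tendsto_atTop_of_hasDerivAt_ge (a := 0) one_pos
        (fun x => ((hd (-x)).scomp x (hasDerivAt_neg x)).neg)
        fun x _ => by simpa using one_le_parabolaSpeed k (-x)
    simpa [Function.comp_def] using
      tendsto_neg_atTop_atBot.comp (h1.comp tendsto_neg_atBot_atTop)
  set G := StrictMono.orderIsoOfSurjective S hm (hSc.surjective htop hbot) with hG
  refine ⟨G.symm, ?_, fun s => ?_, G.symm.tendsto_atTop, G.symm.tendsto_atBot, G.symm.surjective⟩
  · exact G.toHomeomorph.contDiff_symm_deriv (fun x => (hpos x).ne') hd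
      (contDiff_infty_of_hasDerivAt hd (contDiff_parabolaSpeed k))
  · exact HasDerivAt.of_local_left_inverse G.symm.continuous.continuousAt (hd _) (hpos _).ne'
      (Eventually.of_forall fun t => G.apply_symm_apply t)

/-- The parabola has an arclength parametrization; its tangent angle is the arctangent of the
slope, so that its total curvature is `π`. -/
lemma exists_parabola {k : ℝ} (hk : 0 < k) :
    ∃ (Z : ℝ → ℂ) (θ κ : ℝ → ℝ), HasTangentAngle Z θ κ ∧ IsCurvatureFunction κ ∧
      Integrable κ ∧ ∫ s, κ s = Real.pi ∧
      range (fun s => toPlane (Z s)) = standardParabola k := by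
  obtain ⟨X, hXs, hX, htop, hbot, hsurj⟩ := exists_parabola_abscissa k
  have hv : ∀ s, 0 < parabolaSpeed k (X s) := fun x =>
    zero_lt_one.trans_le (one_le_parabolaSpeed k _)
  set κ : ℝ → ℝ := fun s =>
    1 / (1 + (2 * k * X s) ^ 2) * (2 * k * (parabolaSpeed k (X s))⁻¹) with hκ
  have hθ : ∀ s, HasDerivAt (fun s => Real.arctan (2 * k * X s)) (κ s) s := fun s =>
    ((hX s).const_mul (2 * k)).arctan
  have hκc : IsCurvatureFunction κ := by
    refine ⟨?_, fun s => by have := hv s; positivity⟩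
    exact (contDiff_const.div (by fun_prop) fun s => by positivity).mul
      (contDiff_const.mul (((contDiff_parabolaSpeed k).comp hXs).inv fun s => (hv s).ne'))
  have hi : Integrable κ := by
    refine integrable_of_intervalIntegral_norm_bounded (l := atTop) Real.pi (a := fun n : ℝ => -n)
      (b := fun n => n) (fun n => (hκc.smooth.continuous.integrableOn_Icc).mono_set
        Ioc_subset_Icc_self) tendsto_neg_atTop_atBot tendsto_id (Eventually.of_forall fun n => ?_)
    simp only [Real.norm_of_nonneg (hκc.pos _).le]
    rw [intervalIntegral.integral_eq_sub_of_hasDerivAt (fun s _ => hθ s)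
      (hκc.intervalIntegrable _ _)]
    linarith [Real.arctan_lt_pi_div_two (2 * k * X n),
      Real.neg_pi_div_two_lt_arctan (2 * k * X (-n))]
  have hZ : ∀ s, HasDerivAt (fun s => (X s : ℂ) + ((k * X s ^ 2 : ℝ) : ℂ) * Complex.I)
      (Complex.exp (Real.arctan (2 * k * X s) * Complex.I)) s := by
    intro s
    have h1 := (hX s).ofReal_comp.add
      ((((hX s).pow 2).const_mul k).ofReal_comp.mul_const Complex.I)
    refine h1.congr_deriv ?_
    apply Complex.ext
    · rw [Complex.exp_ofReal_mul_I_re, Real.cos_arctan]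
      simp [parabolaSpeed]
    · rw [Complex.exp_ofReal_mul_I_im, Real.sin_arctan]
      simp [parabolaSpeed]
      ring
  refine ⟨_, _, κ, ⟨hZ, hθ⟩, hκc, hi, ?_, ?_⟩
  · have h2k : 0 < 2 * k := by positivity
    rw [integral_of_hasDerivAt_of_tendsto hθ hi
      ((tendsto_nhds_of_tendsto_nhdsWithin Real.tendsto_arctan_atBot).comp
        (hbot.const_mul_atBot h2k))
      ((tendsto_nhds_of_tendsto_nhdsWithin Real.tendsto_arctan_atTop).comp
        (htop.const_mul_atTop h2k))]
    ring
  · have h0 : ∀ x y : ℝ, toPlane (x + y * Complex.I) 0 = x := fun x y => by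
      simp only [toPlane, Complex.orthonormalBasisOneI_repr_apply]
      simp
    have h1 : ∀ x y : ℝ, toPlane (x + y * Complex.I) 1 = y := fun x y => by
      simp only [toPlane, Complex.orthonormalBasisOneI_repr_apply]
      simp
    ext p
    constructor
    · rintro ⟨s, rfl⟩
      change toPlane _ 1 = k * toPlane _ 0 ^ 2
      rw [h0, h1]
    · intro (hp : p 1 = k * p 0 ^ 2)
      obtain ⟨s, hs⟩ := hsurj (p 0)
      refine ⟨s, ?_⟩
      ext i
      fin_cases i
      · exact (h0 _ _).trans hs
      · exact (h1 _ _).trans (by rw [hs]; exact hp.symm)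

/-! ### Arcs of curvature functions -/

lemma crossesAt_of_integral_eq_pi {τ c : ℝ} {κ : ℝ → ℝ → ℝ} (hc : c ∈ Ioo (-τ) τ)
    (hκ : ∀ t ∈ Ioo (-τ) τ, IsCurvatureFunction (κ t))
    (hi : ∀ t ∈ Ioo (-τ) τ, Integrable (κ t))
    (hlt : ∀ t ∈ Ioo (-τ) τ, ∫ s, κ t s < 2 * Real.pi)
    (hm : StrictMonoOn (fun t => ∫ s, κ t s) (Ioo (-τ) τ)) (h : ∫ s, κ c s = Real.pi) :
    CrossesAt τ κ c where
  mem := hc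
  embedded t ht htc _ hP :=
    hP.isEmbedded_of_integral_lt_pi (hκ t ht) (hi t ht) (h ▸ hm ht hc htc)
  not_embedded t ht hct _ hP :=
    ⟨hP.unitSpeed.isImmersed,
      hP.not_isEmbedded_of_pi_lt_integral (hκ t ht) (hi t ht) (h ▸ hm hc ht hct) (hlt t ht)⟩

/-- A curve at a parameter strictly between `c'` and `c` would be both embedded and not embedded.
This gives the uniqueness of the crossing parameter. -/
lemma CrossesAt.le {τ c c' : ℝ} {κ : ℝ → ℝ → ℝ} (h : CrossesAt τ κ c) (h' : CrossesAt τ κ c')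
    (hκ : ∀ t ∈ Ioo (-τ) τ, ∃ P, HasCurvature P (κ t)) : c ≤ c' := by
  by_contra! hlt
  obtain ⟨t, h1, h2⟩ := exists_between hlt
  have ht : t ∈ Ioo (-τ) τ := ⟨h'.mem.1.trans h1, h2.trans h.mem.2⟩
  obtain ⟨P, hP⟩ := hκ t ht
  exact (h'.not_embedded t ht h1 P hP).2 (h.embedded t ht h2 P hP)

/-- The mean value inequality in the parameter: the curvature functions of an arc close to
`κ₀ + t β` grow at a rate between `β - δ` and `β + δ`. -/
lemma ArcClose.growth {τ : ℝ} {κ₀ β δ : ℝ → ℝ} {κ' : ℝ → ℝ → ℝ} (harc : IsArc τ κ')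
    (h : ArcClose τ δ κ' fun t s => κ₀ s + t * β s) {t₁ t₂ : ℝ} (h₁ : t₁ ∈ Ioo (-τ) τ)
    (h₂ : t₂ ∈ Ioo (-τ) τ) (hle : t₁ ≤ t₂) (s : ℝ) :
    (β s - δ s) * (t₂ - t₁) ≤ κ' t₂ s - κ' t₁ s ∧
      κ' t₂ s - κ' t₁ s ≤ (β s + δ s) * (t₂ - t₁) := by
  have hd : ∀ t ∈ Ioo (-τ) τ, |deriv (fun u => κ' u s) t - β s| < δ s := fun t ht => by
    have h1 : HasDerivAt (fun u => κ₀ s + u * β s) (β s) t := by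
      simpa using ((hasDerivAt_id t).mul_const (β s)).const_add (κ₀ s)
    have h2 := (h t ht s).2
    rwa [h1.deriv] at h2
  have hc := (harc.contDiffOn s).continuousOn
  have hdiff : DifferentiableOn ℝ (fun u => κ' u s) (interior (Ioo (-τ) τ)) := by
    rw [interior_Ioo]
    exact (harc.contDiffOn s).differentiableOn (by simp)
  constructor
  · exact (convex_Ioo _ _).mul_sub_le_image_sub_of_le_deriv hc hdiff (fun t ht => by
      rw [interior_Ioo] at ht
      linarith [(abs_lt.1 (hd t ht)).1]) t₁ h₁ t₂ h₂ hle
  · exact (convex_Ioo _ _).image_sub_le_mul_sub_of_deriv_le hc hdiff (fun t ht => by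
      rw [interior_Ioo] at ht
      linarith [(abs_lt.1 (hd t ht)).2]) t₁ h₁ t₂ h₂ hle

/-- The total curvature of an arc close to `κ₀ + t β` is continuous and strictly increasing in the
parameter, and it is close to that of `κ₀ + t β`. -/
lemma ArcClose.integral {τ : ℝ} {κ₀ β δ : ℝ → ℝ} {κ' : ℝ → ℝ → ℝ} (harc : IsArc τ κ')
    (h : ArcClose τ δ κ' fun t s => κ₀ s + t * β s) (hκ₀ : Integrable κ₀) (hβ : Integrable β)
    (hδ : Integrable δ) (hlt : ∫ s, δ s < ∫ s, β s) :
    (∀ t ∈ Ioo (-τ) τ, Integrable (κ' t)) ∧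
      StrictMonoOn (fun t => ∫ s, κ' t s) (Ioo (-τ) τ) ∧
      ContinuousOn (fun t => ∫ s, κ' t s) (Ioo (-τ) τ) ∧
      ∀ t ∈ Ioo (-τ) τ, |(∫ s, κ' t s) - ((∫ s, κ₀ s) + t * ∫ s, β s)| ≤ ∫ s, δ s := by
  have hκ : ∀ t, Integrable fun s => κ₀ s + t * β s := fun t => hκ₀.add (hβ.const_mul t)
  have hi : ∀ t ∈ Ioo (-τ) τ, Integrable (κ' t) := fun t ht => by
    have h1 : Integrable fun s => κ' t s - (κ₀ s + t * β s) :=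
      hδ.mono' (((harc.mem t ht).smooth.continuous.aestronglyMeasurable).sub
        (hκ t).aestronglyMeasurable) (Eventually.of_forall fun s => (h t ht s).1.le)
    simpa [Pi.add_def] using h1.add (hκ t)
  have hg : ∀ t₁ ∈ Ioo (-τ) τ, ∀ t₂ ∈ Ioo (-τ) τ, t₁ ≤ t₂ →
      ((∫ s, β s) - ∫ s, δ s) * (t₂ - t₁) ≤ (∫ s, κ' t₂ s) - ∫ s, κ' t₁ s ∧
        (∫ s, κ' t₂ s) - ∫ s, κ' t₁ s ≤ ((∫ s, β s) + ∫ s, δ s) * (t₂ - t₁) := by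
    intro t₁ h₁ t₂ h₂ hle
    rw [← integral_sub hβ hδ, ← integral_add hβ hδ, ← integral_sub (hi _ h₂) (hi _ h₁),
      ← integral_mul_const, ← integral_mul_const]
    exact ⟨integral_mono ((hβ.sub hδ).mul_const _) ((hi _ h₂).sub (hi _ h₁))
        fun s => (ArcClose.growth harc h h₁ h₂ hle s).1,
      integral_mono ((hi _ h₂).sub (hi _ h₁)) ((hβ.add hδ).mul_const _)
        fun s => (ArcClose.growth harc h h₁ h₂ hle s).2⟩
  have hm : StrictMonoOn (fun t => ∫ s, κ' t s) (Ioo (-τ) τ) := fun t₁ h₁ t₂ h₂ hlt' => by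
    have := mul_pos (sub_pos.2 hlt) (sub_pos.2 hlt')
    exact sub_pos.1 (this.trans_le (hg t₁ h₁ t₂ h₂ hlt'.le).1)
  refine ⟨hi, hm, ?_, fun t ht => ?_⟩
  · refine (LipschitzOnWith.of_le_add_mul (Real.toNNReal ((∫ s, β s) + ∫ s, δ s))
      fun t₁ h₁ t₂ h₂ => ?_).continuousOn
    rcases le_total t₁ t₂ with hle | hle
    · exact (hm.monotoneOn h₁ h₂ hle).trans (le_add_of_nonneg_right (by positivity))
    · rw [Real.dist_eq, abs_of_nonneg (sub_nonneg.2 hle)]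
      have h1 := (hg t₂ h₂ t₁ h₁ hle).2
      have h2 := mul_le_mul_of_nonneg_right (Real.le_coe_toNNReal ((∫ s, β s) + ∫ s, δ s))
        (sub_nonneg.2 hle)
      linarith
  · rw [← integral_const_mul, ← integral_add hκ₀ (hβ.const_mul t),
      ← integral_sub (hi t ht) (hκ t)]
    exact norm_integral_le_of_norm_le (f := fun s => κ' t s - (κ₀ s + t * β s)) hδ
      (Eventually.of_forall fun s => (h t ht s).1.le)

lemma exists_isBump : ∃ β : ℝ → ℝ, IsBump β ∧ Integrable β ∧ 0 < ∫ s, β s := by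
  let f : ContDiffBump (0 : ℝ) := ⟨1 / 2, 1, by norm_num, by norm_num⟩
  refine ⟨f, ⟨f.contDiff, fun s => ⟨f.nonneg, f.le_one⟩, ?_⟩, f.integrable, f.integral_pos⟩
  rw [f.tsupport_eq, Real.closedBall_eq_Icc]
  norm_num [f]

end PlaneCurve

open PlaneCurve

theorem mainTheorem7 (k : ℝ) (hk : 0 < k) :
    ∃ (P₀ : ℝ → PlaneCurve.Plane) (β : ℝ → ℝ) (τ : ℝ) (κ : ℝ → ℝ → ℝ),
      PlaneCurve.IsUnitSpeed P₀ ∧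
      Set.range P₀ = PlaneCurve.standardParabola k ∧
      PlaneCurve.IsBump β ∧
      0 < τ ∧
      (∀ t s, κ t s = PlaneCurve.curvature P₀ s + t * β s) ∧
      PlaneCurve.IsArc τ κ ∧
      (∀ t ∈ Set.Ioo (-τ) τ, ∃ P, PlaneCurve.HasCurvature P (κ t)) ∧
      (∀ t₁ ∈ Set.Ioo (-τ) τ, ∀ t₂ ∈ Set.Ioo (-τ) τ, t₁ < t₂ →
        PlaneCurve.Exceeds (κ t₂) (κ t₁)) ∧
      (∀ t ∈ Set.Ioo (-τ) τ, t < 0 → ∀ P, PlaneCurve.HasCurvature P (κ t) →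
        PlaneCurve.IsEmbedded P) ∧
      (∀ t ∈ Set.Ioo (-τ) τ, 0 < t → ∀ P, PlaneCurve.HasCurvature P (κ t) →
        PlaneCurve.IsImmersed P ∧ ¬ PlaneCurve.IsEmbedded P) ∧
      (∀ P, PlaneCurve.HasCurvature P (κ 0) → PlaneCurve.IsParabola (Set.range P)) ∧
      (∀ η : ℝ, 0 < η → ∃ δ : ℝ → ℝ, Continuous δ ∧ (∀ s, 0 < δ s) ∧
        ∀ κ' : ℝ → ℝ → ℝ, PlaneCurve.IsArc τ κ' → PlaneCurve.ArcClose τ δ κ' κ →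
          (∀ t ∈ Set.Ioo (-τ) τ, ∃ P, PlaneCurve.HasCurvature P (κ' t)) ∧
          ∃ c : ℝ, |c| < η ∧ PlaneCurve.CrossesAt τ κ' c ∧
            ∀ c' : ℝ, PlaneCurve.CrossesAt τ κ' c' → c' = c) := by
  obtain ⟨Z, θ, κ₀, hZ, hκ₀, hi₀, hpi, hrange⟩ := exists_parabola hk
  obtain ⟨β, hβ, hβi, hβpos⟩ := exists_isBump
  have hP₀ := hZ.hasCurvature hκ₀
  set I := ∫ s, β s with hI
  obtain ⟨s₀, -, hs₀⟩ := (isCompact_Icc (a := (-1 : ℝ)) (b := 1)).exists_isMinOn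
    (nonempty_Icc.2 (by norm_num)) hκ₀.smooth.continuous.continuousOn
  -- The first bound on `τ` keeps `κ t` positive on the support of `β`, the second keeps the
  -- total curvature below `2 π`.
  set τ := min (κ₀ s₀ / 2) (1 / (I + 1)) with hτ
  have hτ0 : 0 < τ := lt_min (half_pos (hκ₀.pos s₀)) (by positivity)
  have hτI : τ * I < 1 := by
    have h1 : τ * (I + 1) ≤ 1 := (le_div_iff₀ (by positivity)).1 (min_le_right _ _)
    linarith
  have hpi3 := Real.pi_gt_three
  have harc : IsArc τ fun t s => κ₀ s + t * β s := by
    refine ⟨fun t ht => ⟨hκ₀.smooth.add (contDiff_const.mul hβ.smooth), fun s => ?_⟩,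
      fun s => ContDiff.contDiffOn (by fun_prop)⟩
    by_cases hs : s ∈ Icc (-1 : ℝ) 1
    · have h1 : κ₀ s₀ ≤ κ₀ s := hs₀ hs
      have h2 := hβ.mem_Icc s
      have h3 : τ ≤ κ₀ s₀ / 2 := min_le_left _ _
      nlinarith [ht.1, h2.1, h2.2, hκ₀.pos s₀]
    · rw [image_eq_zero_of_notMem_tsupport (f := β) (x := s) (by rwa [hβ.support_eq])]
      simpa using hκ₀.pos s
  have hκi : ∀ t, Integrable fun s => κ₀ s + t * β s := fun t => hi₀.add (hβi.const_mul t)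
  have hint : ∀ t, ∫ s, κ₀ s + t * β s = Real.pi + t * I := fun t => by
    rw [integral_add hi₀ (hβi.const_mul t), integral_const_mul, hpi]
  have hcross : CrossesAt τ (fun t s => κ₀ s + t * β s) 0 := by
    refine crossesAt_of_integral_eq_pi ⟨by linarith, hτ0⟩ harc.mem (fun t _ => hκi t)
      (fun t ht => ?_) (fun t₁ _ t₂ _ hlt => ?_) ?_
    · rw [hint]
      nlinarith [ht.2]
    · simp only [hint]
      nlinarith
    · rw [hint]
      simp
  refine ⟨fun s => toPlane (Z s), β, τ, fun t s => κ₀ s + t * β s, hP₀.unitSpeed, hrange, hβ, hτ0,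
    fun t s => by rw [hP₀.curvature_eq], harc, fun t ht => (harc.mem t ht).exists_hasCurvature,
    fun t₁ _ t₂ _ hlt => ⟨fun s => ?_, ?_⟩, hcross.embedded, hcross.not_embedded,
    fun P hP => ?_, fun η hη => ?_⟩
  · have := mul_le_mul_of_nonneg_right hlt.le (hβ.mem_Icc s).1
    linarith
  · obtain ⟨s, hs⟩ : ∃ s, β s ≠ 0 := by
      by_contra! h
      simp [hI, h] at hβpos
    have := mul_lt_mul_of_pos_right hlt ((hβ.mem_Icc s).1.lt_of_ne' hs)
    exact ⟨s, by linarith⟩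
  · have hP' : HasCurvature P κ₀ := by simpa using hP
    obtain ⟨Φ, hΦ⟩ := hP'.exists_isometry hκ₀ hZ
    refine ⟨k, hk, Φ, ?_⟩
    rw [← hrange, ← range_comp]
    exact congrArg range (funext hΦ)
  · -- At the parameters `±r` the total curvature differs from `π` by `r I`, twice the total
    -- deviation `∫ δ` that is allowed.
    set r := min η τ / 2 with hr
    have hr0 : 0 < r := by have := lt_min hη hτ0; positivity
    have hrη : r < η := by linarith [min_le_left η τ]
    have hrτ : r < τ := by linarith [min_le_right η τ]
    set δ : ℝ → ℝ := fun s => r * I / 2 / Real.pi * (1 + s ^ 2)⁻¹ with hδ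
    have hδi : Integrable δ := integrable_inv_one_add_sq.const_mul _
    have hδI : ∫ s, δ s = r * I / 2 := by
      rw [hδ, integral_const_mul, integral_univ_inv_one_add_sq]
      field_simp
    have hrI : 0 < r * I := by positivity
    have hrI' : r * I < τ * I := by gcongr
    have hr1 : r < 1 := hrτ.trans_le ((min_le_right _ _).trans
      ((div_le_one (by positivity)).2 (by linarith)))
    refine ⟨δ, ?_, fun s => by positivity, fun κ' harc' hclose => ?_⟩
    · exact continuous_const.mul (Continuous.inv₀ (by fun_prop) fun s => by positivity)
    obtain ⟨hi', hm, hc, happrox⟩ := hclose.integral harc' hi₀ hβi hδi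
      (by rw [hδI, ← hI]; nlinarith)
    simp only [hδI, hpi, ← hI] at happrox
    have hex : ∀ t ∈ Ioo (-τ) τ, ∃ P, HasCurvature P (κ' t) := fun t ht =>
      (harc'.mem t ht).exists_hasCurvature
    have hsub : Icc (-r) r ⊆ Ioo (-τ) τ := Icc_subset_Ioo (by linarith) hrτ
    have hleft := abs_le.1 (happrox (-r) (hsub (left_mem_Icc.2 (by linarith))))
    have hright := abs_le.1 (happrox r (hsub (right_mem_Icc.2 (by linarith))))
    obtain ⟨c, hcr, hcpi⟩ := intermediate_value_Icc (by linarith) (hc.mono hsub)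
      (show Real.pi ∈ Icc _ _ from ⟨by linarith [hleft.2], by linarith [hright.1]⟩)
    have hcross' : CrossesAt τ κ' c :=
      crossesAt_of_integral_eq_pi (hsub hcr) harc'.mem hi' (fun t ht => by
        have h1 := (abs_le.1 (happrox t ht)).2
        have h2 : t * I < τ * I := mul_lt_mul_of_pos_right ht.2 hβpos
        linarith) hm hcpi
    exact ⟨hex, c, (abs_le.2 hcr).trans_lt hrη, hcross', fun c' hc' =>
      le_antisymm (hc'.le hcross' hex) (hcross'.le hc' hex)⟩
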